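/- For integers $q\ge 1$ and $n\ge 0$ let $p_q(n)$ be the number of partitions of $n$ into exactly $q$ positive parts. A function $f:\mathbb N\to\mathbb Q$ ($\mathbb N=\{0,1,2,\dots\}$) is a quasi-polynomial of degree $d$ if $f(n)=\sum_{r=0}^{d}c_r(n)\,n^{d-r}$ for all $n\in\mathbb N$, with each $c_r:\mathbb N\to\mathbb Q$ periodic and $c_0$ not identically zero; $c_r$ is called its codegree $r$ coefficient (with $c_r=0$ for $r>d$). Let $g\in\mathbb Q[x]$ be integer-valued on $\mathbb Z$ and eventually nonnegative, let $S=\{q\in\mathbb N: g(q)\ge 0\}$, let $e:S\to\mathbb N\cup\{-1,\infty\}$, and let $p:\mathbb N\to\mathbb Z_{>0}$ with $p(r)\mid p(r+1)$ for all $r$. A family $\{f_q\}_{q\in S}$ is a two-level quasi-polynomial of degree $g$, depth $e$ and period $p$ if each $f_q$ is a quasi-polynomial of degree $g(q)$, with codegree $r$ coefficient $c_r(n,q)$, and there are polynomials $\phi_{r,i}\in\mathbb Q[x]$ ($r\ge 0$, $0\le i<p(r)$) such that $c_r(n,q)=\phi_{r,\,n\bmod p(r)}(q)$ for all $n\in\mathbb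 N$, $q\in S$ and $0\le r\le e(q)$. For $q\in\mathbb N\setminus S$ one sets $f_q=0$ and $e(q)=-1$. **Theorem.** There is a two-level quasi-polynomial $\{f_q\}$ of degree $q-1$, depth $\lfloor (q-1)/2\rfloor$ and period one (i.e. $p(r)=1$ for all $r$) such that $$f_q(n)=q!\,(q-1)!\,p_q(n)$$ for all integers $q\ge 1$ and $n\ge 0$ with $(q,n)\ne(1,0)$. -/

import Mathlib

/-- `g ∈ ℚ[x]` is a numerical polynomial: it takes integer values at all integers. -/
def IsNumericalPolynomial (g : Polynomial ℚ) : Prop :=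
  ∀ q : ℤ, ∃ k : ℤ, g.eval (q : ℚ) = (k : ℚ)

/-- `c r` (for `r = 0, 1, 2, …`) are the codegree `r` coefficient functions exhibiting
`f : ℕ → ℚ` as a quasi-polynomial of degree `d`: each `c r` is periodic, `c 0` is not identically
zero, `c r = 0` for `r > d`, and `f n = ∑ r ≤ d, c r n * n ^ (d - r)` for every natural `n`
(with `0 ^ 0 = 1`).  Such coefficient functions are uniquely determined by `f` and `d`. -/
structure IsQuasiPolynomialExpansion (f : ℕ → ℚ) (d : ℕ) (c : ℕ → ℕ → ℚ) : Prop where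
  periodic : ∀ r, ∃ m : ℕ, 0 < m ∧ Function.Periodic (c r) m
  leading_ne_zero : ∃ n, c 0 n ≠ 0
  eq_zero_of_lt : ∀ r, d < r → ∀ n, c r n = 0
  eq_sum : ∀ n : ℕ, f n = ∑ r ∈ Finset.range (d + 1), c r n * (n : ℚ) ^ (d - r)

/-- The index set `S = {q ∈ ℕ : g(q) ≥ 0}` attached to a degree function `g`. -/
def degreeSupport (g : Polynomial ℚ) : Set ℕ :=
  {q : ℕ | 0 ≤ g.eval (q : ℚ)}

/-- `f` (a family `f q : ℕ → ℚ`) is a two-level quasi-polynomial of degree `g`, depth `e` and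
period `p`.  The depth takes values in `{-1, 0, 1, 2, …} ∪ {∞}`, a subset of `WithTop ℤ`.
On the index set `S` attached to `g`, `f q` is a quasi-polynomial of degree `g(q)` and, for all
`r ≤ e q`, its codegree `r` coefficient at `n` is `φ r (n mod p r)` evaluated at `q`, where the
polynomials `φ r i` do not depend on `q` or `n`.  Outside `S`, `f q = 0` and `e q = -1`. -/
structure IsTwoLevelQuasiPolynomial (g : Polynomial ℚ) (e : ℕ → WithTop ℤ) (p : ℕ → ℕ)
    (f : ℕ → ℕ → ℚ) : Prop where
  numerical : IsNumericalPolynomial g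
  eventually_nonneg : ∀ᶠ q : ℕ in Filter.atTop, 0 ≤ g.eval (q : ℚ)
  depth_ge : ∀ q, ((-1 : ℤ) : WithTop ℤ) ≤ e q
  period_pos : ∀ r, 0 < p r
  period_dvd : ∀ r, p r ∣ p (r + 1)
  exists_coeff : ∃ φ : ℕ → ℕ → Polynomial ℚ, ∀ q ∈ degreeSupport g, ∃ (d : ℕ) (c : ℕ → ℕ → ℚ),
    (d : ℚ) = g.eval (q : ℚ) ∧ IsQuasiPolynomialExpansion (f q) d c ∧
      ∀ n r : ℕ, ((r : ℤ) : WithTop ℤ) ≤ e q → c r n = (φ r (n % p r)).eval (q : ℚ)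
  eq_zero_of_notMem : ∀ q ∉ degreeSupport g, ∀ n, f q n = 0
  depth_of_notMem : ∀ q ∉ degreeSupport g, e q = ((-1 : ℤ) : WithTop ℤ)

/-- The number of partitions of `n` into exactly `q` (positive) parts. -/
def numPartitions (q n : ℕ) : ℕ :=
  (Finset.univ.filter fun P : Nat.Partition n => P.parts.card = q).card

/-!
Put `q = k + 1` and let `E` be the shift `n ↦ n + 1`. Splitting the partitions of `n + q + 1` into
`q + 1` parts according to whether `1` is a part gives `p_{q+1}(n+q+1) - p_{q+1}(n) = p_q(n+q)`.
Solving this recursion in polynomials, and choosing the constant term so that one factor `E - 1` is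
removed, yields by induction a polynomial `A k` of degree `k` (Sylvester's first wave) such that
`[q]_E! = ∏_{j ≤ q} (1 + E + ⋯ + E ^ (j - 1))` annihilates `p_q - A k`. The induction
starts from `A 0 = 1`, for which `p_1(0)` has to be read as `1`.

As a product of cyclotomic polynomials, `[q]_X!` contains no factor `Φ_1`, and `Φ_d` only
`⌊q/d⌋ ≤ ⌊q/2⌋` times. Hence it divides `(X ^ q! - 1) ^ ⌊q/2⌋`, so `p_q - A k` is a
quasi-polynomial of degree less than `⌊q/2⌋`, and the coefficients of `p_q` of codegree at most
`⌊(q-1)/2⌋` are those of `A k`. Multiplied by `q! (q - 1 - r)!`, the codegree `r` coefficient of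
`A k` satisfies a recursion whose difference in `k` is a combination of those of smaller codegree
with coefficients polynomial in `k`; so it is itself a polynomial in `k`.
-/

noncomputable section

open Finset Polynomial
open scoped Nat

variable {K : Type*} [Field K] [CharZero K]

theorem exists_taylor_sub_self_eq {h : K} (hh : h ≠ 0) {d : ℕ} {P : K[X]} (hP : P.natDegree ≤ d) :
    ∃ Q : K[X], Q.natDegree ≤ d + 1 ∧ taylor h Q - Q = P := by
  induction d generalizing P with
  | zero =>
    refine ⟨C (P.coeff 0 / h) * X, (natDegree_C_mul_le _ _).trans natDegree_X_le, ?_⟩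
    rw [eq_C_of_natDegree_le_zero hP, taylor_mul, taylor_C, taylor_X, ← mul_sub,
      add_sub_cancel_left, ← C_mul, coeff_C_zero, div_mul_cancel₀ _ hh]
  | succ d ih =>
    set a : K := P.coeff (d + 1) / (h * (d + 2))
    have had : a * (h * (d + 2)) = P.coeff (d + 1) :=
      div_mul_cancel₀ _ (mul_ne_zero hh (by norm_cast))
    set M : K[X] := monomial (d + 2) a with hM
    have hcoeff (j : ℕ) : (taylor h M).coeff j = a * (h ^ (d + 2 - j) * (d + 2).choose j) := by
      rw [hM, taylor_monomial, coeff_C_mul, coeff_X_add_C_pow]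
    have hlow : (P - (taylor h M - M)).natDegree ≤ d := by
      refine natDegree_le_iff_coeff_eq_zero.2 fun j hj => ?_
      rw [coeff_sub, coeff_sub, hcoeff, hM, coeff_monomial]
      obtain rfl | rfl | hj : j = d + 1 ∨ j = d + 2 ∨ d + 2 < j := by omega
      · rw [← had, show d + 2 - (d + 1) = 1 by omega, Nat.choose_succ_self_right,
          if_neg (by omega)]
        push_cast
        ring
      · simp [coeff_eq_zero_of_natDegree_lt (hP.trans_lt (Nat.lt_succ_self _))]
      · simp [coeff_eq_zero_of_natDegree_lt (hP.trans_lt (by omega : d + 1 < j)), hj.ne,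
          Nat.choose_eq_zero_of_lt hj]
    obtain ⟨Q, hQ, hQP⟩ := ih hlow
    refine ⟨M + Q, (natDegree_add_le _ _).trans (max_le (natDegree_monomial_le a) (by omega)), ?_⟩
    rw [map_add, add_sub_add_comm, hQP, add_sub_cancel]

theorem exists_polynomial_of_succ_sub_eq_eval {u : ℕ → K} {T : K[X]} {k₀ : ℕ}
    (h : ∀ k, k₀ ≤ k → u (k + 1) - u k = T.eval (k : K)) :
    ∃ S : K[X], ∀ k, k₀ ≤ k → u k = S.eval (k : K) := by
  obtain ⟨Q, -, hQ⟩ := exists_taylor_sub_self_eq one_ne_zero (le_refl T.natDegree)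
  refine ⟨Q + C (u k₀ - Q.eval (k₀ : K)), fun k hk => ?_⟩
  induction k, hk using Nat.le_induction with
  | base => simp
  | succ k hk ih =>
    have hstep : Q.eval ((k : K) + 1) - Q.eval (k : K) = u (k + 1) - u k := by
      rw [h k hk, ← hQ, eval_sub, taylor_eval]
    rw [eval_add, eval_C] at ih ⊢
    push_cast
    linear_combination ih - hstep

theorem factorial_mul_coeff_taylor (h : K) {Q : K[X]} {k m : ℕ} (hQ : Q.natDegree ≤ k + m) :
    (k ! : K) * (taylor h Q).coeff k =
      ∑ j ∈ range (m + 1), ((k + j)! : K) * Q.coeff (k + j) * h ^ j / (j ! : K) := by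
  have hdeg : (hasseDeriv k Q).natDegree < m + 1 := by
    have := natDegree_hasseDeriv_le Q k
    omega
  rw [taylor_coeff, eval_eq_sum_range' hdeg, mul_sum]
  refine sum_congr rfl fun j _ => ?_
  rw [hasseDeriv_coeff, add_comm j k, Nat.cast_add_choose K]
  have hk : (k ! : K) ≠ 0 := mod_cast k.factorial_ne_zero
  field_simp

/-- The recursion satisfied by the polynomial parts `A k` of the numbers of partitions into
`k + 1` parts (Sylvester's first waves): it is `p_{q+1}(n + q + 1) - p_{q+1}(n) = p_q(n + q)`,
written with `q = k + 1`. -/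
structure IsFirstWaveFamily (A : ℕ → K[X]) : Prop where
  zero : A 0 = 1
  natDegree_le (k : ℕ) : (A k).natDegree ≤ k
  taylor_succ_sub (k : ℕ) :
    taylor ((k : K) + 2) (A (k + 1)) - A (k + 1) = taylor ((k : K) + 1) (A k)

/-- The coefficient of codegree `r` in the `k`-th member of a family of polynomials, in the
normalization in which the first-wave recursion becomes a recursion with coefficients polynomial
in `k`. -/
def normalizedCoeff (A : ℕ → K[X]) (r k : ℕ) : K :=
  ((k + 1)! : K) * ((k - r)! : K) * (A k).coeff (k - r)

namespace IsFirstWaveFamily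

variable {A : ℕ → K[X]}

theorem sum_normalizedCoeff_succ (hA : IsFirstWaveFamily A) {r k : ℕ} (hr : r ≤ k) :
    ∑ j ∈ range (r + 1),
        normalizedCoeff A j (k + 1) * ((k : K) + 2) ^ (r - j) / ((r - j + 1)! : K) =
      ∑ j ∈ range (r + 1),
        normalizedCoeff A j k * ((k : K) + 1) ^ (r - j) / ((r - j)! : K) := by
  obtain ⟨l, rfl⟩ := Nat.exists_eq_add_of_le' hr
  have hcoeff := congrArg (fun P : K[X] => ((l + r + 1)! : K) * ((l ! : K) * P.coeff l))
    (hA.taylor_succ_sub (l + r))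
  simp only [coeff_sub, mul_sub] at hcoeff
  rw [factorial_mul_coeff_taylor _ (Q := A (l + r + 1)) (m := r + 1) (hA.natDegree_le _),
    factorial_mul_coeff_taylor _ (m := r) (hA.natDegree_le _), sum_range_succ' _ (r + 1)] at hcoeff
  simp only [add_zero, pow_zero, mul_one, Nat.factorial_zero, Nat.cast_one, div_one, mul_add,
    add_sub_cancel_right, mul_sum] at hcoeff
  refine (sum_range_reflect _ _).symm.trans (Eq.trans ?_ (sum_range_reflect _ _))
  convert hcoeff using 2 with i hi i hi
  all_goals
    have hir : i ≤ r := mem_range_succ_iff.1 hi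
    rw [normalizedCoeff, show r + 1 - 1 - i = r - i by omega, Nat.sub_sub_self hir]
  · rw [show l + r + 1 - (r - i) = l + (i + 1) by omega, Nat.factorial_succ (l + r + 1)]
    push_cast
    ring
  · rw [show l + r - (r - i) = l + i by omega]
    ring

theorem normalizedCoeff_zero (hA : IsFirstWaveFamily A) (k : ℕ) : normalizedCoeff A 0 k = 1 := by
  induction k with
  | zero => simp [normalizedCoeff, hA.zero]
  | succ k ih => simpa [ih] using hA.sum_normalizedCoeff_succ k.zero_le

theorem exists_polynomial_normalizedCoeff (hA : IsFirstWaveFamily A) (r : ℕ) :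
    ∃ S : K[X], ∀ k, r ≤ k → normalizedCoeff A r k = S.eval (k : K) := by
  induction r using Nat.strong_induction_on with
  | _ r ih =>
    choose! S hS using ih
    refine exists_polynomial_of_succ_sub_eq_eval (T := ∑ j ∈ range r,
      (C ((r - j)! : K)⁻¹ * (X + 1) ^ (r - j) * S j
        - C ((r - j + 1)! : K)⁻¹ * (X + 2) ^ (r - j) * taylor 1 (S j))) fun k hk => ?_
    have hrec := hA.sum_normalizedCoeff_succ hk
    rw [sum_range_succ, sum_range_succ] at hrec
    simp only [Nat.sub_self, pow_zero, mul_one, zero_add, Nat.factorial_one, Nat.factorial_zero,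
      Nat.cast_one, div_one] at hrec
    rw [← eq_sub_iff_add_eq', add_sub_right_comm, ← sub_eq_iff_eq_add, ← sum_sub_distrib] at hrec
    rw [hrec, eval_finsetSum]
    refine sum_congr rfl fun j hj => ?_
    have hjr : j < r := mem_range.1 hj
    rw [hS j hjr k (by omega), hS j hjr (k + 1) (by omega)]
    simp only [eval_sub, eval_mul, eval_C, eval_pow, eval_add, eval_X, eval_one, eval_ofNat,
      taylor_eval]
    push_cast
    ring

theorem coeff_self_ne_zero (hA : IsFirstWaveFamily A) (k : ℕ) : (A k).coeff k ≠ 0 := fun h => by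
  simpa [normalizedCoeff, h] using hA.normalizedCoeff_zero k

theorem natDegree_eq (hA : IsFirstWaveFamily A) (k : ℕ) : (A k).natDegree = k :=
  natDegree_eq_of_le_of_coeff_ne_zero (hA.natDegree_le k) (hA.coeff_self_ne_zero k)

theorem ne_zero (hA : IsFirstWaveFamily A) (k : ℕ) : A k ≠ 0 :=
  fun h => hA.coeff_self_ne_zero k (by rw [h, coeff_zero])

theorem exists_polynomial_coeff (hA : IsFirstWaveFamily A) :
    ∃ c : ℕ → K[X], ∀ k r, r ≤ k →
      ((k + 1)! : K) * (k ! : K) * (A k).coeff (k - r) = (c r).eval (k : K) := by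
  choose S hS using hA.exists_polynomial_normalizedCoeff
  refine ⟨fun r => descPochhammer K r * S r, fun k r hr => ?_⟩
  rw [eval_mul, ← hS r k hr, descPochhammer_eval_eq_descFactorial, normalizedCoeff,
    ← Nat.factorial_mul_descFactorial hr]
  push_cast
  ring

end IsFirstWaveFamily

open fwdDiff_aux (shiftₗ shiftₗ_pow_apply)

section Annihilates

variable {G : Type*} [AddCommGroup G]

/-- `P` annihilates the sequence `f` if `P(E) f = 0`, where `E` is the shift `f ↦ f (· + 1)`. -/
def Annihilates (P : ℤ[X]) (f : ℕ → G) : Prop :=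
  aeval (shiftₗ ℕ G 1) P f = 0

theorem annihilates_mul {P Q : ℤ[X]} {f : ℕ → G} :
    Annihilates (P * Q) f ↔ Annihilates P (aeval (shiftₗ ℕ G 1) Q f) := by
  rw [Annihilates, Annihilates, map_mul, Module.End.mul_apply]

theorem Annihilates.of_dvd {P Q : ℤ[X]} {f : ℕ → G} (hP : Annihilates P f) (h : P ∣ Q) :
    Annihilates Q f := by
  obtain ⟨R, rfl⟩ := h
  rw [mul_comm, annihilates_mul, Annihilates, show aeval (shiftₗ ℕ G 1) P f = 0 from hP, map_zero]

theorem aeval_shift_X_pow_sub_one (N : ℕ) :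
    ⇑(aeval (shiftₗ ℕ G 1) (X ^ N - 1 : ℤ[X])) = fwdDiff N := by
  ext f n
  simp [shiftₗ_pow_apply, fwdDiff]

theorem annihilates_X_pow_sub_one_pow_iff {N m : ℕ} {f : ℕ → G} :
    Annihilates ((X ^ N - 1) ^ m) f ↔ (fwdDiff N)^[m] f = 0 := by
  rw [Annihilates, map_pow, Module.End.pow_apply, aeval_shift_X_pow_sub_one]

theorem aeval_shift_const (P : ℤ[X]) (c : G) :
    aeval (shiftₗ ℕ G 1) P (fun _ => c) = fun _ => P.eval 1 • c := by
  ext n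
  simp [aeval_eq_sum_range, eval_eq_sum_range, LinearMap.sum_apply, Finset.sum_apply,
    shiftₗ_pow_apply, sum_smul]

theorem annihilates_X_sub_one_iff {f : ℕ → G} : Annihilates (X - 1) f ↔ ∀ n, f n = f 0 := by
  rw [← pow_one (X - 1 : ℤ[X])]
  nth_rw 1 [← pow_one (X : ℤ[X])]
  rw [annihilates_X_pow_sub_one_pow_iff, Function.iterate_one, funext_iff]
  refine ⟨fun h n => ?_, fun h n => by simp [fwdDiff, h (n + 1), h n]⟩
  induction n with
  | zero => rfl
  | succ n ih => rw [← ih]; exact sub_eq_zero.1 (h n)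

end Annihilates

theorem exists_annihilates_sub_const {P : ℤ[X]} (hP : P.eval 1 ≠ 0) {f : ℕ → K}
    (h : Annihilates ((X - 1) * P) f) : ∃ c : K, Annihilates P fun n => f n - c := by
  rw [annihilates_mul, annihilates_X_sub_one_iff] at h
  have hP' : ((P.eval 1 : ℤ) : K) ≠ 0 := Int.cast_ne_zero.2 hP
  refine ⟨aeval (shiftₗ ℕ K 1) P f 0 / (P.eval 1 : ℤ), ?_⟩
  rw [Annihilates, show (fun n => f n - _) = f - fun _ => _ from rfl, map_sub, aeval_shift_const]
  ext n
  rw [Pi.sub_apply, h n, zsmul_eq_mul, mul_div_cancel₀ _ hP', sub_self, Pi.zero_apply]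

/-- The `q`-factorial `[q]! = ∏ (1 + X + ⋯ + X ^ j)`, the product being over `j < q`. -/
def qFactorial (q : ℕ) : ℤ[X] :=
  ∏ j ∈ range q, ∑ i ∈ range (j + 1), X ^ i

theorem X_sub_one_mul_qFactorial_succ (q : ℕ) :
    (X - 1) * qFactorial (q + 1) = qFactorial q * (X ^ (q + 1) - 1) := by
  rw [qFactorial, prod_range_succ, ← geom_sum_mul, qFactorial]
  ring

theorem eval_one_qFactorial (q : ℕ) : (qFactorial q).eval 1 = q ! := by
  simp [qFactorial, eval_prod, eval_finsetSum, ← prod_range_add_one_eq_factorial]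

theorem qFactorial_eq_prod_cyclotomic (q : ℕ) :
    qFactorial q = ∏ d ∈ Icc 2 q, cyclotomic d ℤ ^ (q / d) := by
  have hfactor : ∀ j ∈ range q, (∑ i ∈ range (j + 1), X ^ i : ℤ[X]) =
      ∏ d ∈ Icc 2 q, if d ∣ j + 1 then cyclotomic d ℤ else 1 := by
    intro j hj
    have hdivisors : (j + 1).divisors.erase 1 = {d ∈ Icc 2 q | d ∣ j + 1} := by
      ext d
      have hjq := mem_range.1 hj
      have hpos : d ∣ j + 1 → 0 < d := fun h => Nat.pos_of_dvd_of_pos h j.succ_pos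
      have hle : d ∣ j + 1 → d ≤ j + 1 := Nat.le_of_dvd j.succ_pos
      simp only [mem_erase, Nat.mem_divisors, mem_filter, mem_Icc]
      grind
    rw [← prod_cyclotomic_eq_geom_sum j.succ_pos, ← prod_filter, hdivisors]
  rw [qFactorial, prod_congr rfl hfactor, prod_comm]
  refine prod_congr rfl fun d _ => ?_
  rw [← prod_filter, prod_const, Nat.card_multiples]

theorem qFactorial_dvd (q : ℕ) : qFactorial q ∣ (X ^ (q !) - 1) ^ (q / 2) := by
  have hdvd : ∏ d ∈ Icc 2 q, cyclotomic d ℤ ∣ X ^ (q !) - 1 := by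
    rw [← prod_cyclotomic_eq_X_pow_sub_one q.factorial_pos]
    refine prod_dvd_prod_of_subset _ _ _ fun d hd => ?_
    obtain ⟨hd2, hdq⟩ := mem_Icc.1 hd
    exact Nat.mem_divisors.2 ⟨Nat.dvd_factorial (by omega) hdq, q.factorial_ne_zero⟩
  calc qFactorial q = ∏ d ∈ Icc 2 q, cyclotomic d ℤ ^ (q / d) := qFactorial_eq_prod_cyclotomic q
    _ ∣ ∏ d ∈ Icc 2 q, cyclotomic d ℤ ^ (q / 2) := prod_dvd_prod_of_dvd _ _ fun d hd =>
        pow_dvd_pow _ (Nat.div_le_div_left (mem_Icc.1 hd).1 two_pos)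
    _ = (∏ d ∈ Icc 2 q, cyclotomic d ℤ) ^ (q / 2) := prod_pow _ _ _
    _ ∣ (X ^ (q !) - 1) ^ (q / 2) := pow_dvd_pow_of_dvd hdvd _

theorem eq_sum_choose_smul_fwdDiff_iter {G : Type*} [AddCommGroup G] {f : ℕ → G} {N m : ℕ}
    (hf : (fwdDiff N)^[m] f = 0) (b t : ℕ) :
    f (b + t * N) = ∑ k ∈ range m, t.choose k • (fwdDiff N)^[k] f b := by
  have hvanish : ∀ k, m ≤ k → (fwdDiff N)^[k] f = 0 := by
    intro k hk
    rw [← Nat.sub_add_cancel hk, Function.iterate_add_apply, hf]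
    exact Function.iterate_fixed (fwdDiff_const N 0) _
  rw [← smul_eq_mul, shift_eq_sum_fwdDiff_iter N f]
  refine sum_congr_of_eq_on_inter (fun k _ hk => ?_) (fun k _ hk => ?_) fun _ _ _ => rfl
  · rw [hvanish k (by simpa using hk), Pi.zero_apply, smul_zero]
  · rw [Nat.choose_eq_zero_of_lt (by simpa using hk), zero_smul]

theorem exists_polynomial_mod_of_fwdDiff_iter_eq_zero {f : ℕ → K} {N m : ℕ} (hN : N ≠ 0)
    (hf : (fwdDiff N)^[m] f = 0) :
    ∃ P : ℕ → K[X], (∀ b, (P b).degree < m) ∧ ∀ n : ℕ, f n = (P (n % N)).eval (n : K) := by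
  let P (b : ℕ) : K[X] := ∑ k ∈ range m,
    C ((fwdDiff N)^[k] f b / k !) * (descPochhammer K k).comp (C (N : K)⁻¹ * (X - C (b : K)))
  refine ⟨P, fun b => ?_, fun n => ?_⟩
  · refine (degree_sum_le _ _).trans_lt ?_
    refine (Finset.sup_lt_iff (WithBot.bot_lt_coe m)).2 fun k hk => ?_
    have hlin : (C (N : K)⁻¹ * (X - C (b : K))).natDegree ≤ 1 :=
      (natDegree_C_mul_le _ _).trans (natDegree_X_sub_C_le _)
    have hterm := calc
      (C ((fwdDiff N)^[k] f b / k !) *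
          (descPochhammer K k).comp (C (N : K)⁻¹ * (X - C (b : K)))).natDegree
        ≤ (descPochhammer K k).natDegree * (C (N : K)⁻¹ * (X - C (b : K))).natDegree :=
          (natDegree_C_mul_le _ _).trans natDegree_comp_le
      _ ≤ k * 1 := by rw [descPochhammer_natDegree]; gcongr
      _ < m := by simpa using hk
    exact degree_le_natDegree.trans_lt (WithBot.coe_lt_coe.2 hterm)
  · have hn : ((n / N : ℕ) : K) = (N : K)⁻¹ * (n - (n % N : ℕ)) := by
      have hN' : (N : K) ≠ 0 := Nat.cast_ne_zero.2 hN
      rw [eq_inv_mul_iff_mul_eq₀ hN', eq_sub_iff_add_eq']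
      exact_mod_cast Nat.mod_add_div n N
    conv_lhs => rw [← Nat.mod_add_div' n N, eq_sum_choose_smul_fwdDiff_iter hf]
    rw [eval_finsetSum]
    refine sum_congr rfl fun k _ => ?_
    simp only [eval_mul, eval_C, eval_comp, eval_sub, eval_X]
    rw [← hn, nsmul_eq_mul, Nat.cast_choose_eq_descPochhammer_div]
    ring

theorem IsQuasiPolynomialExpansion.const_mul {f : ℕ → ℚ} {d : ℕ} {c : ℕ → ℕ → ℚ} {a : ℚ}
    (ha : a ≠ 0) (hf : IsQuasiPolynomialExpansion f d c) :
    IsQuasiPolynomialExpansion (fun n => a * f n) d (fun r n => a * c r n) where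
  periodic r := by
    obtain ⟨m, hm, hper⟩ := hf.periodic r
    exact ⟨m, hm, fun n => congrArg (a * ·) (hper n)⟩
  leading_ne_zero := hf.leading_ne_zero.imp fun n hn => mul_ne_zero ha hn
  eq_zero_of_lt r hr n := by rw [hf.eq_zero_of_lt r hr n, mul_zero]
  eq_sum n := by simp only [hf.eq_sum n, mul_sum, mul_assoc]

theorem exists_isQuasiPolynomialExpansion_of_annihilates {f : ℕ → ℚ} {A : ℚ[X]} {N m : ℕ}
    (hN : N ≠ 0) (hA : A ≠ 0) (hm : m ≤ A.natDegree)
    (hf : Annihilates ((X ^ N - 1) ^ m) fun n => f n - A.eval (n : ℚ)) :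
    ∃ c, IsQuasiPolynomialExpansion f A.natDegree c ∧
      ∀ r, r + m ≤ A.natDegree → ∀ n, c r n = A.coeff (A.natDegree - r) := by
  set d := A.natDegree
  obtain ⟨P, hPdeg, hP⟩ := exists_polynomial_mod_of_fwdDiff_iter_eq_zero hN
    (annihilates_X_pow_sub_one_pow_iff.1 hf)
  have hhigh (r : ℕ) (hr : r + m ≤ d) (n : ℕ) : (P (n % N)).coeff (d - r) = 0 :=
    coeff_eq_zero_of_degree_lt ((hPdeg _).trans_le (Nat.cast_le.2 (by omega)))
  refine ⟨fun r n => if r ≤ d then A.coeff (d - r) + (P (n % N)).coeff (d - r) else 0, ?_, ?_⟩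
  · refine ⟨fun r => ⟨N, by omega, fun n => by simp⟩, ⟨0, ?_⟩, fun r hr n => if_neg hr.not_ge, ?_⟩
    · rw [if_pos d.zero_le, hhigh 0 (by omega), add_zero]
      exact leadingCoeff_ne_zero.2 hA
    · intro n
      have hdeg : (A + P (n % N)).natDegree < d + 1 := by
        refine Nat.lt_succ_of_le ((natDegree_add_le _ _).trans (max_le le_rfl ?_))
        exact natDegree_le_of_degree_le ((hPdeg _).le.trans (Nat.cast_le.2 hm))
      calc f n = (A + P (n % N)).eval (n : ℚ) := by rw [eval_add, ← hP n, add_sub_cancel]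
        _ = ∑ j ∈ range (d + 1), (A + P (n % N)).coeff j * (n : ℚ) ^ j :=
          eval_eq_sum_range' hdeg _
        _ = _ := by
          rw [← sum_range_reflect]
          refine sum_congr rfl fun r hr => ?_
          rw [if_pos (mem_range_succ_iff.1 hr), coeff_add, Nat.add_sub_cancel]
  · intro r hr n
    beta_reduce
    rw [if_pos (by omega), hhigh r hr, add_zero]

theorem card_filter_mem_parts {a n : ℕ} (ha : 1 ≤ a) (han : a ≤ n) (q : ℕ) :
    #{P : Nat.Partition n | P.parts.card = q + 1 ∧ a ∈ P.parts} = numPartitions q (n - a) := by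
  let e := Nat.Partition.partitionWithPartEquiv ha han
  have he (P) : (e P).parts = P.1.parts.erase a :=
    Nat.Partition.partitionWithPartEquiv_apply_parts ha han P
  have he' (Q) : (e.symm Q).1.parts = a ::ₘ Q.parts :=
    Nat.Partition.partitionWithPartEquiv_symm_apply_parts ha han Q
  refine card_bij' (fun P hP => e ⟨P, (mem_filter.1 hP).2.2⟩) (fun Q _ => (e.symm Q).1)
    (fun P hP => ?_) (fun Q hQ => ?_) (fun P _ => ?_) fun Q _ => ?_
  · obtain ⟨hcard, hmem⟩ := (mem_filter.1 hP).2
    exact mem_filter.2 ⟨mem_univ _, by rw [he, Multiset.card_erase_of_mem hmem, hcard]; rfl⟩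
  · refine mem_filter.2 ⟨mem_univ _, ?_, (e.symm Q).2⟩
    rw [he', Multiset.card_cons, (mem_filter.1 hQ).2]
  · rw [Equiv.symm_apply_apply]
  · exact e.apply_symm_apply Q

theorem card_filter_one_notMem_parts (q n : ℕ) :
    #{P : Nat.Partition (n + q) | P.parts.card = q ∧ 1 ∉ P.parts} = numPartitions q n := by
  have hsum (s : Multiset ℕ) : (s.map (· + 1)).sum = s.sum + s.card := by
    simp [Multiset.sum_map_add]
  refine (card_bij (fun P hP => ⟨P.parts.map (· + 1), by simp, ?sum⟩) (fun P hP => ?_)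
    (fun P _ Q _ h => ?_) fun Q hQ => ?_).symm
  case sum => rw [hsum, P.parts_sum, (mem_filter.1 hP).2]
  · have hzero : 0 ∉ P.parts := fun h => (P.parts_pos h).ne rfl
    simpa [hzero] using hP
  · exact Nat.Partition.ext
      (Multiset.map_injective (add_left_injective 1) (congrArg Nat.Partition.parts h))
  · obtain ⟨hcard, hone⟩ := (mem_filter.1 hQ).2
    have hlift : (Q.parts.map (· - 1)).map (· + 1) = Q.parts := by
      rw [Multiset.map_map]
      exact (Multiset.map_congr rfl fun i hi => Nat.sub_add_cancel (Q.parts_pos hi)).trans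
        (Multiset.map_id _)
    refine ⟨⟨Q.parts.map (· - 1), fun hi => ?_, ?_⟩, ?_, Nat.Partition.ext hlift⟩
    · obtain ⟨j, hj, rfl⟩ := Multiset.mem_map.1 hi
      have hj0 := Q.parts_pos hj
      have hj1 : j ≠ 1 := fun h => hone (h ▸ hj)
      omega
    · have := hsum (Q.parts.map (· - 1))
      rw [hlift, Q.parts_sum, Multiset.card_map, hcard] at this
      omega
    · simpa using hcard

theorem numPartitions_succ_add (q n : ℕ) :
    numPartitions (q + 1) (n + (q + 1)) = numPartitions q (n + q) + numPartitions (q + 1) n := by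
  rw [← card_filter_one_notMem_parts (q + 1) n,
    show n + q = n + (q + 1) - 1 from rfl, ← card_filter_mem_parts le_rfl (by omega) q,
    numPartitions, ← card_filter_add_card_filter_not (1 ∈ Nat.Partition.parts ·), filter_filter,
    filter_filter]

theorem numPartitions_one {n : ℕ} (hn : n ≠ 0) : numPartitions 1 n = 1 := by
  refine card_eq_one.2 ⟨.indiscrete n, eq_singleton_iff_unique_mem.2 ⟨?_, fun P hP => ?_⟩⟩
  · simp [Nat.Partition.indiscrete_parts hn]
  · obtain ⟨a, ha⟩ := Multiset.card_eq_one.1 (mem_filter.1 hP).2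
    have hsum := P.parts_sum
    rw [ha, Multiset.sum_singleton] at hsum
    exact Nat.Partition.ext (by rw [ha, hsum, Nat.Partition.indiscrete_parts hn])

/-- The number of partitions of `n` into `k + 1` parts, as a rational number, with the value at
`k = n = 0` changed from `0` to `1`, which makes the sequence for `k = 0` constant. -/
def adjustedNumPartitions (k n : ℕ) : ℚ :=
  if k = 0 then 1 else numPartitions (k + 1) n

theorem adjustedNumPartitions_eq {k n : ℕ} (h : k = 0 → n ≠ 0) :
    adjustedNumPartitions k n = numPartitions (k + 1) n := by
  rw [adjustedNumPartitions, ite_eq_right_iff]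
  rintro rfl
  rw [numPartitions_one (h rfl), Nat.cast_one]

theorem adjustedNumPartitions_succ_add (k n : ℕ) :
    adjustedNumPartitions (k + 1) (n + (k + 2)) =
      adjustedNumPartitions k (n + (k + 1)) + adjustedNumPartitions (k + 1) n := by
  rw [adjustedNumPartitions_eq (by simp), adjustedNumPartitions_eq (by simp),
    adjustedNumPartitions_eq (by simp), numPartitions_succ_add (k + 1) n, Nat.cast_add]

theorem annihilates_sub_eval_of_taylor_sub_self_eq {k : ℕ} {A Q : ℚ[X]}
    (hA : Annihilates (qFactorial (k + 1)) fun n => adjustedNumPartitions k n - A.eval (n : ℚ))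
    (hQ : taylor ((k : ℚ) + 2) Q - Q = taylor ((k : ℚ) + 1) A) :
    Annihilates ((X - 1) * qFactorial (k + 2))
      fun n => adjustedNumPartitions (k + 1) n - Q.eval (n : ℚ) := by
  have hshift : aeval (shiftₗ ℕ ℚ 1) (X ^ (k + 2) - 1 : ℤ[X])
        (fun n => adjustedNumPartitions (k + 1) n - Q.eval (n : ℚ)) =
      aeval (shiftₗ ℕ ℚ 1) (X ^ (k + 1) : ℤ[X])
        fun n => adjustedNumPartitions k n - A.eval (n : ℚ) := by
    ext n
    have hQn := congrArg (eval (n : ℚ)) hQ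
    rw [eval_sub, taylor_eval, taylor_eval] at hQn
    rw [aeval_shift_X_pow_sub_one, aeval_X_pow, shiftₗ_pow_apply, fwdDiff, smul_eq_mul, mul_one,
      adjustedNumPartitions_succ_add]
    push_cast
    linear_combination -hQn
  rw [X_sub_one_mul_qFactorial_succ, annihilates_mul, hshift, ← annihilates_mul]
  exact hA.of_dvd (dvd_mul_right _ _)

theorem exists_annihilates_adjustedNumPartitions_succ_sub_eval (k : ℕ) (A : ℚ[X])
    (hdeg : A.natDegree ≤ k)
    (hA : Annihilates (qFactorial (k + 1)) fun n => adjustedNumPartitions k n - A.eval (n : ℚ)) :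
    ∃ A' : ℚ[X], (A'.natDegree ≤ k + 1 ∧ Annihilates (qFactorial (k + 2))
        fun n => adjustedNumPartitions (k + 1) n - A'.eval (n : ℚ)) ∧
      taylor ((k : ℚ) + 2) A' - A' = taylor ((k : ℚ) + 1) A := by
  obtain ⟨Q, hQdeg, hQ⟩ := exists_taylor_sub_self_eq (h := (k : ℚ) + 2) (by positivity)
    ((natDegree_taylor A ((k : ℚ) + 1)).trans_le hdeg)
  obtain ⟨c, hc⟩ := exists_annihilates_sub_const
    (by rw [eval_one_qFactorial]; exact_mod_cast (k + 2).factorial_ne_zero)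
    (annihilates_sub_eval_of_taylor_sub_self_eq hA hQ)
  refine ⟨Q + C c, ⟨natDegree_add_C.trans_le hQdeg, ?_⟩, ?_⟩
  · simpa only [eval_add, eval_C, sub_add_eq_sub_sub] using hc
  · rw [map_add, taylor_C, add_sub_add_right_eq_sub, hQ]

theorem exists_isFirstWaveFamily_annihilates :
    ∃ A : ℕ → ℚ[X], IsFirstWaveFamily A ∧ ∀ k,
      Annihilates (qFactorial (k + 1)) fun n => adjustedNumPartitions k n - (A k).eval (n : ℚ) := by
  choose! nextWave hnext hrec using exists_annihilates_adjustedNumPartitions_succ_sub_eval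
  let A : ℕ → ℚ[X] := Nat.rec 1 nextWave
  have hA (k : ℕ) : (A k).natDegree ≤ k ∧
      Annihilates (qFactorial (k + 1))
        fun n => adjustedNumPartitions k n - (A k).eval (n : ℚ) := by
    induction k with
    | zero => simp [A, adjustedNumPartitions, Annihilates, ← Pi.zero_def]
    | succ k ih => exact hnext k (A k) ih.1 ih.2
  exact ⟨A, ⟨rfl, fun k => (hA k).1, fun k => hrec k (A k) (hA k).1 (hA k).2⟩, fun k => (hA k).2⟩

/-- The family `q! (q - 1)! p_q(n)` with `p_1(0)` replaced by `1`, and zero for `q = 0`. -/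
def scaledNumPartitions : ℕ → ℕ → ℚ
  | 0, _ => 0
  | k + 1, n => ((k + 1)! : ℚ) * (k ! : ℚ) * adjustedNumPartitions k n

theorem scaledNumPartitions_eq {q n : ℕ} (hq : 1 ≤ q) (hqn : ¬(q = 1 ∧ n = 0)) :
    scaledNumPartitions q n = (q ! : ℚ) * ((q - 1)! : ℚ) * (numPartitions q n : ℚ) := by
  obtain ⟨k, rfl⟩ := Nat.exists_eq_add_of_le' hq
  rw [scaledNumPartitions, adjustedNumPartitions_eq (by grind), Nat.add_sub_cancel]

theorem exists_isQuasiPolynomialExpansion_scaledNumPartitions :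
    ∃ S : ℕ → ℚ[X], ∀ k, ∃ c : ℕ → ℕ → ℚ,
      IsQuasiPolynomialExpansion (scaledNumPartitions (k + 1)) k c ∧
        ∀ r, r ≤ k / 2 → ∀ n, c r n = (S r).eval (k : ℚ) := by
  obtain ⟨A, hA, hann⟩ := exists_isFirstWaveFamily_annihilates
  obtain ⟨S, hS⟩ := hA.exists_polynomial_coeff
  refine ⟨S, fun k => ?_⟩
  have hdeg : (A k).natDegree = k := hA.natDegree_eq k
  obtain ⟨c, hc, hlow⟩ := exists_isQuasiPolynomialExpansion_of_annihilates (A := A k)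
    (k + 1).factorial_ne_zero (hA.ne_zero k) (by rw [hdeg]; omega)
    ((hann k).of_dvd (qFactorial_dvd _))
  rw [hdeg] at hc hlow
  refine ⟨_, hc.const_mul (a := ((k + 1)! : ℚ) * (k ! : ℚ)) (by positivity), fun r hr n => ?_⟩
  rw [hlow r (by omega), hS k r (by omega)]

theorem mem_degreeSupport_X_sub_one {q : ℕ} : q ∈ degreeSupport (X - 1) ↔ 1 ≤ q := by
  simp [degreeSupport]

theorem isTwoLevelQuasiPolynomial_scaledNumPartitions :
    IsTwoLevelQuasiPolynomial (X - 1) (fun q => ((((q : ℤ) - 1) / 2 : ℤ) : WithTop ℤ))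
      (fun _ => 1) scaledNumPartitions where
  numerical q := ⟨q - 1, by simp⟩
  eventually_nonneg := by
    filter_upwards [Filter.eventually_ge_atTop 1] with q hq
    exact mem_degreeSupport_X_sub_one.2 hq
  depth_ge q := WithTop.coe_le_coe.2 (by omega)
  period_pos _ := one_pos
  period_dvd _ := dvd_rfl
  exists_coeff := by
    obtain ⟨S, hS⟩ := exists_isQuasiPolynomialExpansion_scaledNumPartitions
    refine ⟨fun r _ => (S r).comp (X - 1), fun q hq => ?_⟩
    obtain ⟨k, rfl⟩ := Nat.exists_eq_add_of_le' (mem_degreeSupport_X_sub_one.1 hq)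
    obtain ⟨c, hc, hlow⟩ := hS k
    refine ⟨k, c, by simp, hc, fun n r hr => ?_⟩
    have hrk : r ≤ k / 2 := by
      have := WithTop.coe_le_coe.1 hr
      push_cast at this
      omega
    rw [hlow r hrk n]
    simp
  eq_zero_of_notMem q hq n := by
    obtain rfl : q = 0 := by simpa [mem_degreeSupport_X_sub_one] using hq
    rfl
  depth_of_notMem q hq := by
    obtain rfl : q = 0 := by simpa [mem_degreeSupport_X_sub_one] using hq
    rfl

end

/-- The family `q! (q-1)! p_q(n)` (`q ≥ 1`, `n ≥ 0`) is given by a two-level quasi-polynomial of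
degree `q - 1`, depth `⌊(q-1)/2⌋` (integer floor division) and period one; the only pair left out
is `(q, n) = (1, 0)`, since `p_1(0) = 0` while `p_1(n) = 1` for all `n ≥ 1`. -/
theorem mainTheorem10 :
    ∃ f : ℕ → ℕ → ℚ,
      IsTwoLevelQuasiPolynomial (Polynomial.X - 1)
        (fun q => ((((q : ℤ) - 1) / 2 : ℤ) : WithTop ℤ)) (fun _ => 1) f ∧
      ∀ q n : ℕ, 1 ≤ q → ¬ (q = 1 ∧ n = 0) →
        f q n = (q.factorial : ℚ) * ((q - 1).factorial : ℚ) * (numPartitions q n : ℚ) :=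
  ⟨scaledNumPartitions, isTwoLevelQuasiPolynomial_scaledNumPartitions,
    fun _ _ => scaledNumPartitions_eq⟩
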